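/- Let $M$ be a smooth manifold without boundary. An almost Kähler structure on $M$ is a triple $(\omega,\Theta,g)$ consisting of a symplectic form $\omega$ (a smooth, closed, nondegenerate 2-form), an almost complex structure $\Theta$ (a smooth endomorphism field with $\Theta^2=-1$), and a smooth Riemannian metric $g$ with $g(\Theta X,\Theta Y)=g(X,Y)$ and $\omega(X,Y)=g(\Theta X,Y)$. It is Kähler if moreover $\Theta$ is integrable, i.e. the Nijenhuis tensor $[\Theta X,\Theta Y]-\Theta[\Theta X,Y]-\Theta[X,\Theta Y]-[X,Y]$ vanishes for all vector fields $X,Y$. A symplectic connection of $(M,\omega)$ is a smooth torsion-free linear connection $\nabla$ with $\nabla\omega=0$. The $g$-dual of a smooth linear connection $\nabla$ is the smooth linear connection $\nabla^*$ with $X\cdot g(Y,Z)=g(\nabla_XY,Z)+g(Y,\nabla^*_XZ)$ for all vector fields $X,Y,Z$. A pair $(\nabla,\nabla^*)$ of $g$-dual connections is called statistical if both are torsion-free. The almost Kähler manifold $(M,\omega,\Theta,g)$ is called statistical almost Kähler if there is a symplectic connection $\nabla$ of $(M,\omega)$ such that $(\nabla,\nabla^*)$ is statistical, i.e. such that its $g$-dual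 $\nabla^*$ is also torsion-free. **Proposition.** Let $(M,\omega,\Theta,g)$ be an almost Kähler manifold. 1. $(M,\omega,\Theta,g)$ is Kähler if and only if it is statistical almost Kähler. 2. Call a Riemannian metric $h$ on $M$ a Hermitian (respectively Kähler) metric of the symplectic manifold $(M,\omega)$ if there is an almost complex structure $J$ such that $(\omega,J,h)$ is an almost Kähler (respectively Kähler) structure. Then a Riemannian metric $h$ on $M$ is a Kähler metric of $(M,\omega)$ if and only if it is a Hermitian metric of $(M,\omega)$ and there is a symplectic connection of $(M,\omega)$ whose $h$-dual is again a symplectic connection of $(M,\omega)$. -/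

import Mathlib

open Bundle Set
open scoped Manifold ContDiff Bundle

noncomputable section

namespace AlmostKahlerGeometry

variable {E : Type*} [NormedAddCommGroup E] [NormedSpace ℝ E]
  {H : Type*} [TopologicalSpace H] (I : ModelWithCorners ℝ E H)
  (M : Type*) [TopologicalSpace M] [ChartedSpace H M]

/-- A (not necessarily smooth) vector field on `M`. -/
abbrev Field : Type _ := Π x : M, TangentSpace I x

/-- A (not necessarily smooth) field of bilinear forms on the tangent spaces of `M`. -/
abbrev BilinField : Type _ := Π x : M, TangentSpace I x →L[ℝ] TangentSpace I x →L[ℝ] ℝ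

/-- A (not necessarily smooth) field of endomorphisms of the tangent spaces of `M`. -/
abbrev EndField : Type _ := Π x : M, TangentSpace I x →L[ℝ] TangentSpace I x

/-- A linear connection on `M`, i.e. a covariant derivative on the tangent bundle. In Mathlib's
argument order, `D Y x (X x)` is the value at `x` of the covariant derivative of `Y` along `X`. -/
abbrev LinearConnection [IsManifold I ∞ M] : Type _ :=
  CovariantDerivative I E (fun x : M ↦ TangentSpace I x)

/-- A smooth Riemannian metric on `M`; `g.inner x v w` is the scalar product of `v, w` at `x`. -/
abbrev Metric [IsManifold I ∞ M] : Type _ :=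
  ContMDiffRiemannianMetric I ∞ E (fun x : M ↦ TangentSpace I x)

variable {I M}

/-- Smooth vector fields. -/
def IsSmoothField [IsManifold I ∞ M] (X : Field I M) : Prop :=
  ContMDiff I (I.prod 𝓘(ℝ, E)) ∞ (fun x ↦ TotalSpace.mk' E x (X x))

/-- Smooth `(0,2)`-tensor fields. -/
def IsSmoothBilin [IsManifold I ∞ M] (b : BilinField I M) : Prop :=
  ContMDiff I (I.prod 𝓘(ℝ, E →L[ℝ] E →L[ℝ] ℝ)) ∞
    (fun x ↦ TotalSpace.mk' (E →L[ℝ] E →L[ℝ] ℝ) x (b x))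

/-- Smooth `(1,1)`-tensor fields. -/
def IsSmoothEnd [IsManifold I ∞ M] (A : EndField I M) : Prop :=
  ContMDiff I (I.prod 𝓘(ℝ, E →L[ℝ] E)) ∞ (fun x ↦ TotalSpace.mk' (E →L[ℝ] E) x (A x))

/-- The derivative `X · f` of a function along a vector field. -/
def lieDeriv (X : Field I M) (f : M → ℝ) (x : M) : ℝ := mvfderiv I f x (X x)

/-- The function `b(X, Y)`. -/
def pair (b : BilinField I M) (X Y : Field I M) (x : M) : ℝ := b x (X x) (Y x)

/-- The vector field `A X`. -/
def act (A : EndField I M) (X : Field I M) : Field I M := fun x ↦ A x (X x)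

/-- The vector field `∇_X Y`. -/
def along [IsManifold I ∞ M] (D : LinearConnection I M) (X Y : Field I M) : Field I M := fun x ↦ D Y x (X x)

/-- Invariant formula for the exterior derivative of a 2-form:
`X·Ω(Y,Z) + Y·Ω(Z,X) + Z·Ω(X,Y) - Ω([X,Y],Z) - Ω([Y,Z],X) - Ω([Z,X],Y)`. -/
def extDerivTwoForm (Ω : BilinField I M) (X Y Z : Field I M) (x : M) : ℝ :=
  lieDeriv X (pair Ω Y Z) x + lieDeriv Y (pair Ω Z X) x + lieDeriv Z (pair Ω X Y) x
    - pair Ω (VectorField.mlieBracket I X Y) Z x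
    - pair Ω (VectorField.mlieBracket I Y Z) X x
    - pair Ω (VectorField.mlieBracket I Z X) Y x

/-- A symplectic form: a smooth, closed, nondegenerate 2-form. -/
structure IsSymplecticForm [IsManifold I ∞ M] (Ω : BilinField I M) : Prop where
  smooth : IsSmoothBilin Ω
  alternating : ∀ (x : M) (v : TangentSpace I x), Ω x v v = 0
  nondegenerate : ∀ (x : M) (v : TangentSpace I x), (∀ w, Ω x v w = 0) → v = 0
  closed : ∀ X Y Z : Field I M, IsSmoothField X → IsSmoothField Y → IsSmoothField Z →
    ∀ x, extDerivTwoForm Ω X Y Z x = 0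

/-- An almost complex structure: a smooth endomorphism field with square `-1`. -/
structure IsAlmostComplex [IsManifold I ∞ M] (Θ : EndField I M) : Prop where
  smooth : IsSmoothEnd Θ
  sq : ∀ (x : M) (v : TangentSpace I x), Θ x (Θ x v) = -v

/-- The Nijenhuis tensor `[ΘX,ΘY] - Θ[ΘX,Y] - Θ[X,ΘY] + Θ²[X,Y]`, where `Θ² = -1`. -/
def nijenhuis (Θ : EndField I M) (X Y : Field I M) (x : M) : TangentSpace I x :=
  VectorField.mlieBracket I (act Θ X) (act Θ Y) x
    - Θ x (VectorField.mlieBracket I (act Θ X) Y x)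
    - Θ x (VectorField.mlieBracket I X (act Θ Y) x)
    - VectorField.mlieBracket I X Y x

/-- Integrability of an almost complex structure: its Nijenhuis tensor vanishes. -/
def IsIntegrable [IsManifold I ∞ M] (Θ : EndField I M) : Prop :=
  ∀ X Y : Field I M, IsSmoothField X → IsSmoothField Y → ∀ x, nijenhuis Θ X Y x = 0

/-- `(M, Ω, Θ, g)` is almost Kähler: `Ω` is a symplectic form, `Θ` is an almost complex structure,
`g` is a Hermitian metric, and `Ω = g(Θ·,·)`. -/
structure IsAlmostKahler [IsManifold I ∞ M]
    (Ω : BilinField I M) (Θ : EndField I M) (g : Metric I M) : Prop where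
  symplectic : IsSymplecticForm Ω
  almostComplex : IsAlmostComplex Θ
  hermitian : ∀ (x : M) (v w : TangentSpace I x), g.inner x (Θ x v) (Θ x w) = g.inner x v w
  fundamental : ∀ (x : M) (v w : TangentSpace I x), Ω x v w = g.inner x (Θ x v) w

/-- `(M, Ω, Θ, g)` is Kähler: it is almost Kähler and `Θ` is integrable. -/
structure IsKahler [IsManifold I ∞ M]
    (Ω : BilinField I M) (Θ : EndField I M) (g : Metric I M) : Prop where
  almostKahler : IsAlmostKahler Ω Θ g
  integrable : IsIntegrable Θ

/-- A smooth linear connection: it maps smooth fields to smooth fields. -/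
def IsSmoothConnection [IsManifold I ∞ M] (D : LinearConnection I M) : Prop :=
  CovariantDerivative.ContMDiffCovariantDerivative D ∞

/-- A torsion-free linear connection: `∇_X Y - ∇_Y X = [X, Y]`. -/
def IsTorsionFree [IsManifold I ∞ M] [FiniteDimensional ℝ E] [CompleteSpace E]
    (D : LinearConnection I M) : Prop :=
  D.torsion = 0

/-- `∇Ω = 0`. -/
def IsParallel [IsManifold I ∞ M] (D : LinearConnection I M) (Ω : BilinField I M) : Prop :=
  ∀ X Y Z : Field I M, IsSmoothField X → IsSmoothField Y → IsSmoothField Z → ∀ x,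
    lieDeriv X (pair Ω Y Z) x = pair Ω (along D X Y) Z x + pair Ω Y (along D X Z) x

/-- A symplectic connection of `(M, Ω)`: a smooth torsion-free linear connection with `∇Ω = 0`. -/
structure IsSymplecticConnection [IsManifold I ∞ M] [FiniteDimensional ℝ E] [CompleteSpace E]
    (Ω : BilinField I M) (D : LinearConnection I M) : Prop where
  smooth : IsSmoothConnection D
  torsionFree : IsTorsionFree D
  parallel : IsParallel D Ω

/-- `(∇, ∇*)` is a dualistic structure on `(M, g)`, i.e. `∇*` is the `g`-dual connection of `∇`:
`X·g(Y,Z) = g(∇_X Y, Z) + g(Y, ∇*_X Z)`. -/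
structure IsDual [IsManifold I ∞ M] (g : Metric I M) (D D' : LinearConnection I M) : Prop where
  smooth_left : IsSmoothConnection D
  smooth_right : IsSmoothConnection D'
  duality : ∀ X Y Z : Field I M, IsSmoothField X → IsSmoothField Y → IsSmoothField Z → ∀ x,
    lieDeriv X (pair g.inner Y Z) x =
      pair g.inner (along D X Y) Z x + pair g.inner Y (along D' X Z) x

/-- Statistical connections on `(M, g)`: dual connections both of which are torsion-free. -/
structure IsStatistical [IsManifold I ∞ M] [FiniteDimensional ℝ E] [CompleteSpace E]
    (g : Metric I M) (D D' : LinearConnection I M) : Prop where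
  dual : IsDual g D D'
  torsionFree_left : IsTorsionFree D
  torsionFree_right : IsTorsionFree D'

/-- The pairs `(∇, ∇*)` consisting of a symplectic connection of `(M, Ω)` and its `g`-dual. -/
def symplecticDualPairs [IsManifold I ∞ M] [FiniteDimensional ℝ E] [CompleteSpace E]
    (Ω : BilinField I M) (g : Metric I M) : Set (LinearConnection I M × LinearConnection I M) :=
  {p | IsSymplecticConnection Ω p.1 ∧ IsDual g p.1 p.2}

/-- `(M, Ω, Θ, g)` is statistical almost Kähler: it is almost Kähler, and some symplectic connection
forms with its `g`-dual a pair of statistical connections. -/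
structure IsStatisticalAlmostKahler [IsManifold I ∞ M] [FiniteDimensional ℝ E] [CompleteSpace E]
    (Ω : BilinField I M) (Θ : EndField I M) (g : Metric I M) : Prop where
  almostKahler : IsAlmostKahler Ω Θ g
  exists_statistical : ∃ p ∈ symplecticDualPairs Ω g, IsStatistical g p.1 p.2

/-- `g` is a Hermitian metric of the symplectic manifold `(M, Ω)`: it is the metric of an almost
Kähler structure `(Ω, Θ, g)`. -/
def IsHermitianMetric [IsManifold I ∞ M] (Ω : BilinField I M) (g : Metric I M) : Prop :=
  ∃ Θ : EndField I M, IsAlmostKahler Ω Θ g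

/-- `g` is a Kähler metric of the symplectic manifold `(M, Ω)`: it is the metric of a Kähler
structure `(Ω, Θ, g)`. -/
def IsKahlerMetric [IsManifold I ∞ M] (Ω : BilinField I M) (g : Metric I M) : Prop :=
  ∃ Θ : EndField I M, IsKahler Ω Θ g

end AlmostKahlerGeometry

end

/-!
Since `Ω = g(Θ·,·)`, the `g`-dual of a symplectic connection `∇` is `∇* = -Θ∇Θ`. If both connections
are torsion-free, then `Θ[X,Y] = ∇_X ΘY - ∇_Y ΘX`, and substituting this into the mixed terms of the
Nijenhuis tensor, and `[X,Y] = ∇_X Y - ∇_Y X` into the others, makes it cancel.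

Conversely, the Levi-Civita connection `∇` of any almost Hermitian manifold satisfies
`2 g((∇_X Θ)Y, Z) = dΩ(X,Y,Z) - dΩ(X,ΘY,ΘZ) + g(N(Y,Z),ΘX)`. On a Kähler manifold it is therefore a
symplectic connection, and it is its own dual. It is constructed from the Koszul formula, whose
right-hand side `K` satisfies `K(X,Y,Z) - K(Y,X,Z) = 2 g([X,Y],Z)` and
`K(X,Y,Z) + K(X,Z,Y) = 2 X·g(Y,Z)`: these say that `∇` is torsion-free and metric, and they reduce
the behaviour of `K` in `X` and `Y` to its tensoriality in `Z`.
-/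

namespace AlmostKahlerGeometry

section HomBundle

variable {𝕜 : Type*} [NontriviallyNormedField 𝕜]
  {E : Type*} [NormedAddCommGroup E] [NormedSpace 𝕜 E]
  {H : Type*} [TopologicalSpace H] {I : ModelWithCorners 𝕜 E H}
  {M : Type*} [TopologicalSpace M] [ChartedSpace H M]
  {F : Type*} [NormedAddCommGroup F] [NormedSpace 𝕜 F] {V : M → Type*}
  [TopologicalSpace (TotalSpace F V)] [∀ x, AddCommGroup (V x)] [∀ x, Module 𝕜 (V x)]
  [∀ x, TopologicalSpace (V x)] [FiberBundle F V] [VectorBundle 𝕜 F V]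
  {F' : Type*} [NormedAddCommGroup F'] [NormedSpace 𝕜 F'] {W : M → Type*}
  [TopologicalSpace (TotalSpace F' W)] [∀ x, AddCommGroup (W x)] [∀ x, Module 𝕜 (W x)]
  [∀ x, TopologicalSpace (W x)] [∀ x, IsTopologicalAddGroup (W x)] [∀ x, ContinuousSMul 𝕜 (W x)]
  [FiberBundle F' W] [VectorBundle 𝕜 F' W]
  {n : ℕ∞ω} {φ : Π x : M, V x →L[𝕜] W x} {x₀ : M}

lemma contMDiffAt_hom_of_forall_apply [CompleteSpace 𝕜] [FiniteDimensional 𝕜 F]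
    [ContMDiffVectorBundle n F V I]
    (h : ∀ σ : Π x, V x, CMDiffAt n (T% σ) x₀ →
      CMDiffAt n (fun x ↦ TotalSpace.mk' F' x (φ x (σ x))) x₀) :
    CMDiffAt n (fun x ↦ TotalSpace.mk' (F →L[𝕜] F') (E := fun x ↦ V x →L[𝕜] W x) x (φ x)) x₀ := by
  let e := trivializationAt F V x₀
  let e' := trivializationAt F' W x₀
  have hx₀ : x₀ ∈ e.baseSet := FiberBundle.mem_baseSet_trivializationAt' x₀
  have hx₀' : x₀ ∈ e'.baseSet := FiberBundle.mem_baseSet_trivializationAt' x₀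
  let b := Module.finBasis 𝕜 F
  have contMDiffAt_sum_coord : CMDiffAt n (fun x ↦ ∑ i,
      (LinearMap.toContinuousLinearMap (b.coord i)).smulRight
        (e' ⟨x, φ x (e.localFrame b i x)⟩).2) x₀ := by
    refine ContMDiffAt.sum fun i _ ↦ ?_
    have hφ := (contMDiffAt_section _).1 (h _ (contMDiffAt_localFrame_of_mem n e b i hx₀))
    exact (ContinuousLinearMap.smulRightL 𝕜 F F'
      (LinearMap.toContinuousLinearMap (b.coord i))).contMDiff.contMDiffAt.comp x₀ hφ
  refine (contMDiffAt_hom_bundle _).2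
    ⟨contMDiffAt_id, contMDiffAt_sum_coord.congr_of_eventuallyEq ?_⟩
  filter_upwards [e.open_baseSet.mem_nhds hx₀, e'.open_baseSet.mem_nhds hx₀'] with x hx hx'
  refine ContinuousLinearMap.coe_injective (b.ext fun j ↦ ?_)
  rw [ContinuousLinearMap.inCoordinates_eq hx hx']
  simp [Finsupp.single_apply, e', e.localFrame_apply_of_mem_baseSet b hx, Trivialization.basisAt, e]

lemma contMDiffAt_hom_inverse [∀ x, IsTopologicalAddGroup (V x)] [∀ x, ContinuousSMul 𝕜 (V x)]
    [CompleteSpace F]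
    (hφ : CMDiffAt n (fun x ↦ TotalSpace.mk' (F →L[𝕜] F') (E := fun x ↦ V x →L[𝕜] W x)
      x (φ x)) x₀) (hinv : (φ x₀).IsInvertible) :
    CMDiffAt n (fun x ↦ TotalSpace.mk' (F' →L[𝕜] F) (E := fun x ↦ W x →L[𝕜] V x)
      x (φ x).inverse) x₀ := by
  have hx₀ := FiberBundle.mem_baseSet_trivializationAt' (F := F) (E := V) x₀
  have hx₀' := FiberBundle.mem_baseSet_trivializationAt' (F := F') (E := W) x₀
  rw [contMDiffAt_hom_bundle] at hφ ⊢
  have hinv₀ : (ContinuousLinearMap.inCoordinates F V F' W x₀ x₀ x₀ x₀ (φ x₀)).IsInvertible := by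
    rw [ContinuousLinearMap.inCoordinates_eq hx₀ hx₀']
    exact ContinuousLinearMap.isInvertible_equiv.comp
      (hinv.comp ContinuousLinearMap.isInvertible_equiv)
  refine ⟨contMDiffAt_id, (hinv₀.contDiffAt_map_inverse.contMDiffAt.comp x₀
    hφ.2).congr_of_eventuallyEq ?_⟩
  filter_upwards [(trivializationAt F V x₀).open_baseSet.mem_nhds hx₀,
    (trivializationAt F' W x₀).open_baseSet.mem_nhds hx₀'] with x hx hx'
  rw [Function.comp_apply, ContinuousLinearMap.inCoordinates_eq hx hx',
    ContinuousLinearMap.inCoordinates_eq hx' hx]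
  simp [ContinuousLinearMap.comp_assoc]

end HomBundle

section RealBundle

variable {E : Type*} [NormedAddCommGroup E] [NormedSpace ℝ E]
  {H : Type*} [TopologicalSpace H] {I : ModelWithCorners ℝ E H}
  {M : Type*} [TopologicalSpace M] [ChartedSpace H M]
  {F : Type*} [NormedAddCommGroup F] [NormedSpace ℝ F] {V : M → Type*}
  [TopologicalSpace (TotalSpace F V)] [∀ x, AddCommGroup (V x)] [∀ x, Module ℝ (V x)]
  [∀ x, TopologicalSpace (V x)] [FiberBundle F V] [VectorBundle ℝ F V]
  {n : ℕ∞ω} {x : M}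

lemma exists_contMDiff_section_eq [FiniteDimensional ℝ E] [T2Space M] [IsManifold I ∞ M]
    [ContMDiffVectorBundle ∞ F V I] (v : V x) : ∃ σ : Π x, V x, CMDiff ∞ (T% σ) ∧ σ x = v := by
  obtain ⟨s, hs, hσ⟩ := FiberBundle.exists_contMDiffOn_extend (k := ∞) I F v
  obtain ⟨u, hus, hu, hxu⟩ := mem_nhds_iff.1 hs
  obtain ⟨χ, -, hχ⟩ :=
    (SmoothBumpFunction.nhds_basis_tsupport (I := I) x).mem_iff.1 (hu.mem_nhds hxu)
  refine ⟨(χ : M → ℝ) • FiberBundle.extend F v,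
    ContMDiffOn.smul_section_of_tsupport χ.contMDiff.contMDiffOn hu hχ (hσ.mono hus), ?_⟩
  simp

lemma eq_of_forall_inner_eq (g : ContMDiffRiemannianMetric I n F V) {v w : V x}
    (h : ∀ u, g.inner x v u = g.inner x w u) : v = w := by
  by_contra hne
  have hpos := g.pos x (v - w) (sub_ne_zero.2 hne)
  simp [h] at hpos

lemma clm_eq_of_forall_inner_eq {F' : Type*} [NormedAddCommGroup F'] [NormedSpace ℝ F']
    {W : M → Type*} [TopologicalSpace (TotalSpace F' W)] [∀ x, AddCommGroup (W x)]
    [∀ x, Module ℝ (W x)] [∀ x, TopologicalSpace (W x)] [FiberBundle F' W]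
    (g : ContMDiffRiemannianMetric I n F V) {A B : W x →L[ℝ] V x}
    (h : ∀ (τ : Π x, W x) (σ : Π x, V x), MDiffAt (T% τ) x → MDiffAt (T% σ) x →
      g.inner x (A (τ x)) (σ x) = g.inner x (B (τ x)) (σ x)) : A = B := by
  ext v
  refine eq_of_forall_inner_eq g fun u ↦ ?_
  simpa using h (FiberBundle.extend F' v) (FiberBundle.extend F u)
    (FiberBundle.mdifferentiableAt_extend ..) (FiberBundle.mdifferentiableAt_extend ..)

lemma isInvertible_inner [FiniteDimensional ℝ F] (g : ContMDiffRiemannianMetric I n F V) (x : M) :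
    (g.inner x).IsInvertible := by
  have : T2Space (V x) := FiberBundle.t2Space F V x
  have : FiniteDimensional ℝ (V x) := VectorBundle.finiteDimensional ℝ F V x
  have : IsTopologicalAddGroup (V x) :=
    (VectorBundle.continuousLinearEquivAt ℝ F V x).toContinuousAddEquiv.isTopologicalAddGroup
  have : ContinuousSMul ℝ (V x) :=
    (VectorBundle.continuousLinearEquivAt ℝ F V x).continuousSMul
  have injective_inner : Function.Injective (g.inner x).toLinearMap := fun v w h ↦
    eq_of_forall_inner_eq g fun u ↦ congr($h u)
  have finrank_eq : Module.finrank ℝ (V x) = Module.finrank ℝ (V x →L[ℝ] ℝ) :=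
    (Subspace.dual_finrank_eq (K := ℝ) (V := V x)).symm.trans
      (LinearMap.toContinuousLinearMap (E := V x) (F' := ℝ)).finrank_eq
  exact ⟨(LinearEquiv.ofInjectiveOfFinrankEq _ injective_inner
    finrank_eq).toContinuousLinearEquiv, by ext; rfl⟩

lemma contMDiffAt_section_of_forall_inner [FiniteDimensional ℝ F]
    [∀ x, IsTopologicalAddGroup (V x)] [∀ x, ContinuousSMul ℝ (V x)] [ContMDiffVectorBundle n F V I]
    (g : ContMDiffRiemannianMetric I n F V) {σ : Π x, V x}
    (h : ∀ τ : Π x, V x, CMDiffAt n (T% τ) x → CMDiffAt n (fun y ↦ g.inner y (σ y) (τ y)) x) :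
    CMDiffAt n (T% σ) x := by
  have contMDiffAt_flat : CMDiffAt n (fun y ↦ TotalSpace.mk' (F →L[ℝ] ℝ)
      (E := fun y ↦ V y →L[ℝ] Bundle.Trivial M ℝ y) y (g.inner y (σ y))) x :=
    contMDiffAt_hom_of_forall_apply fun τ hτ ↦ contMDiffAt_totalSpace.2 ⟨contMDiffAt_id, h τ hτ⟩
  have contMDiffAt_sharp := contMDiffAt_hom_inverse (W := fun y ↦ V y →L[ℝ] Bundle.Trivial M ℝ y)
    (g.contMDiff x) (isInvertible_inner g x)
  simpa [(isInvertible_inner g _).inverse_apply_self] using!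
    contMDiffAt_sharp.clm_bundle_apply contMDiffAt_flat

end RealBundle

section VectorFields

variable {E : Type*} [NormedAddCommGroup E] [NormedSpace ℝ E]
  {H : Type*} [TopologicalSpace H] {I : ModelWithCorners ℝ E H}
  {M : Type*} [TopologicalSpace M] [ChartedSpace H M] {n : ℕ∞ω} {x : M}
  {b : BilinField I M} {f h : M → ℝ}

lemma pair_comm (hs : ∀ x v w, b x v w = b x w v) (X Y : Field I M) : pair b X Y = pair b Y X :=
  funext fun x ↦ hs x _ _

lemma pair_smul_right (b : BilinField I M) (f : M → ℝ) (X Y : Field I M) :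
    pair b X (f • Y) = f * pair b X Y := by
  funext x; simp [pair]

lemma pair_add_right (b : BilinField I M) (X Y Y' : Field I M) :
    pair b X (Y + Y') = pair b X Y + pair b X Y' := by
  funext x; simp [pair]

lemma pair_neg_left (b : BilinField I M) (X Y : Field I M) : pair b (-X) Y = -pair b X Y := by
  funext x; simp [pair]

lemma pair_neg_right (b : BilinField I M) (X Y : Field I M) : pair b X (-Y) = -pair b X Y := by
  funext x; simp [pair]

lemma lieDeriv_smul_field (f h : M → ℝ) (X : Field I M) :
    lieDeriv (f • X) h x = f x * lieDeriv X h x := by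
  simp [lieDeriv]

lemma lieDeriv_add_field (h : M → ℝ) (X X' : Field I M) :
    lieDeriv (X + X') h x = lieDeriv X h x + lieDeriv X' h x := by
  simp [lieDeriv]

lemma lieDeriv_mul (X : Field I M) (hf : MDiffAt f x) (hh : MDiffAt h x) :
    lieDeriv X (f * h) x = f x * lieDeriv X h x + h x * lieDeriv X f x := by
  simp [lieDeriv, mvfderiv_mul hf hh]

lemma lieDeriv_add (X : Field I M) (hf : MDiffAt f x) (hh : MDiffAt h x) :
    lieDeriv X (f + h) x = lieDeriv X f x + lieDeriv X h x := by
  simp [lieDeriv, mvfderiv_add hf hh]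

lemma lieDeriv_neg (f : M → ℝ) (X : Field I M) : lieDeriv X (-f) x = -lieDeriv X f x := by
  simp [lieDeriv, mvfderiv_neg]

lemma contMDiffAt_lieDeriv {m : ℕ∞ω} [IsManifold I 1 M] {X : Field I M}
    (hf : CMDiffAt n f x) (hX : CMDiffAt m (T% X) x) (hmn : m + 1 ≤ n) :
    CMDiffAt m (lieDeriv X f) x := by
  have h := (hf.mfderiv_const hmn).clm_apply_of_inCoordinates hX (hf.of_le (le_self_add.trans hmn))
  simpa [lieDeriv, mvfderiv] using! (contMDiffAt_totalSpace.1 h).2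

variable [IsManifold I ∞ M] {X Y : Field I M}

lemma contMDiffAt_pair (hb : IsSmoothBilin b) (hX : CMDiffAt ∞ (T% X) x)
    (hY : CMDiffAt ∞ (T% Y) x) : CMDiffAt ∞ (pair b X Y) x := by
  have : ContMDiffAt I (I.prod 𝓘(ℝ)) ∞
      (fun y ↦ TotalSpace.mk' ℝ (E := Bundle.Trivial M ℝ) y (b y (X y) (Y y))) x :=
    ContMDiffAt.clm_bundle_apply₂ (F₁ := E) (F₂ := E) (hb x) hX hY
  exact (contMDiffAt_totalSpace.1 this).2

lemma mdifferentiableAt_pair (hb : IsSmoothBilin b) (hX : MDiffAt (T% X) x)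
    (hY : MDiffAt (T% Y) x) : MDiffAt (pair b X Y) x := by
  have : MDifferentiableAt I (I.prod 𝓘(ℝ))
      (fun y ↦ TotalSpace.mk' ℝ (E := Bundle.Trivial M ℝ) y (b y (X y) (Y y))) x :=
    MDifferentiableAt.clm_bundle_apply₂ (F₁ := E) (F₂ := E)
      ((hb x).mdifferentiableAt (by simp)) hX hY
  exact ((mdifferentiableAt_totalSpace ..).1 this).2

lemma contMDiffAt_mlieBracket [CompleteSpace E] (hX : CMDiffAt ∞ (T% X) x)
    (hY : CMDiffAt ∞ (T% Y) x) : CMDiffAt ∞ (T% (VectorField.mlieBracket I X Y)) x := by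
  have : IsManifold I (∞ + 1) M := by rwa [show (∞ + 1 : ℕ∞ω) = ∞ from rfl]
  have : IsManifold I (minSmoothness ℝ 3) M := by
    rw [minSmoothness_of_isRCLikeNormedField]; infer_instance
  exact ContMDiffAt.mlieBracket_vectorField (m := ⊤) (n := ⊤) hX hY
    (by rw [minSmoothness_of_isRCLikeNormedField]; simp)

lemma IsSmoothField.mdiffAt (hX : IsSmoothField X) (x : M) : MDiffAt (T% X) x :=
  (hX x).mdifferentiableAt (by simp)

lemma IsSmoothField.act {A : EndField I M} (hA : IsSmoothEnd A) (hX : IsSmoothField X) :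
    IsSmoothField (act A X) :=
  ContMDiff.clm_bundle_apply (F₁ := E) (F₂ := E) hA hX

end VectorFields

section Koszul

variable {E : Type*} [NormedAddCommGroup E] [NormedSpace ℝ E]
  {H : Type*} [TopologicalSpace H] {I : ModelWithCorners ℝ E H}
  {M : Type*} [TopologicalSpace M] [ChartedSpace H M] {x : M}
  {b : BilinField I M} {X X' Y Y' Z Z' : Field I M} {f : M → ℝ}

/-- The right-hand side of the Koszul formula for `2 b(∇_X Y, Z)`, where `∇` is the Levi-Civita
connection of the symmetric form `b`. -/
noncomputable def koszul (b : BilinField I M) (X Y Z : Field I M) (x : M) : ℝ :=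
  lieDeriv X (pair b Y Z) x + lieDeriv Y (pair b X Z) x - lieDeriv Z (pair b X Y) x
    + pair b (VectorField.mlieBracket I X Y) Z x
    - pair b (VectorField.mlieBracket I X Z) Y x
    - pair b (VectorField.mlieBracket I Y Z) X x

lemma koszul_sub_koszul_swap_left (hs : ∀ x v w, b x v w = b x w v) (X Y Z : Field I M) (x : M) :
    koszul b X Y Z x - koszul b Y X Z x = 2 * pair b (VectorField.mlieBracket I X Y) Z x := by
  rw [koszul, koszul, pair_comm hs Y X, VectorField.mlieBracket_swap (V := Y) (W := X)]
  simp only [pair, Pi.neg_apply, map_neg, neg_apply]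
  ring

lemma koszul_add_koszul_swap_right (hs : ∀ x v w, b x v w = b x w v) (X Y Z : Field I M) (x : M) :
    koszul b X Y Z x + koszul b X Z Y x = 2 * lieDeriv X (pair b Y Z) x := by
  rw [koszul, koszul, pair_comm hs Z Y, VectorField.mlieBracket_swap (V := Z) (W := Y)]
  simp only [pair, Pi.neg_apply, map_neg, neg_apply]
  ring

variable [IsManifold I ∞ M]

lemma contMDiffAt_koszul [CompleteSpace E] (hb : IsSmoothBilin b) (hX : CMDiffAt ∞ (T% X) x)
    (hY : CMDiffAt ∞ (T% Y) x) (hZ : CMDiffAt ∞ (T% Z) x) : CMDiffAt ∞ (koszul b X Y Z) x := by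
  have contMDiffAt_lieDeriv_pair {U V W : Field I M} (hU : CMDiffAt ∞ (T% U) x)
      (hV : CMDiffAt ∞ (T% V) x) (hW : CMDiffAt ∞ (T% W) x) :
      CMDiffAt ∞ (lieDeriv U (pair b V W)) x :=
    contMDiffAt_lieDeriv (contMDiffAt_pair hb hV hW) hU (by simp)
  have contMDiffAt_pair_bracket {U V W : Field I M} (hU : CMDiffAt ∞ (T% U) x)
      (hV : CMDiffAt ∞ (T% V) x) (hW : CMDiffAt ∞ (T% W) x) :
      CMDiffAt ∞ (pair b (VectorField.mlieBracket I U V) W) x :=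
    contMDiffAt_pair hb (contMDiffAt_mlieBracket hU hV) hW
  exact (((((contMDiffAt_lieDeriv_pair hX hY hZ).add (contMDiffAt_lieDeriv_pair hY hX hZ)).sub
    (contMDiffAt_lieDeriv_pair hZ hX hY)).add (contMDiffAt_pair_bracket hX hY hZ)).sub
    (contMDiffAt_pair_bracket hX hZ hY)).sub (contMDiffAt_pair_bracket hY hZ hX)

variable [CompleteSpace E]

lemma koszul_smul_right (hb : IsSmoothBilin b) (hs : ∀ x v w, b x v w = b x w v)
    (hf : MDiffAt f x) (hX : MDiffAt (T% X) x) (hY : MDiffAt (T% Y) x) (hZ : MDiffAt (T% Z) x) :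
    koszul b X Y (f • Z) x = f x * koszul b X Y Z x := by
  simp only [koszul, pair_smul_right, lieDeriv_smul_field, Pi.mul_apply,
    lieDeriv_mul _ hf (mdifferentiableAt_pair hb hX hZ),
    lieDeriv_mul _ hf (mdifferentiableAt_pair hb hY hZ)]
  simp only [pair, VectorField.mlieBracket_smul_right hf hZ, map_add, map_smul, lieDeriv,
    add_apply, smul_apply, smul_eq_mul, hs x (Z x)]
  ring

lemma koszul_smul_middle (hb : IsSmoothBilin b) (hs : ∀ x v w, b x v w = b x w v)
    (hf : MDiffAt f x) (hX : MDiffAt (T% X) x) (hY : MDiffAt (T% Y) x) (hZ : MDiffAt (T% Z) x) :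
    koszul b X (f • Y) Z x = f x * koszul b X Y Z x + 2 * (lieDeriv X f x * pair b Y Z x) := by
  have h_smul := koszul_add_koszul_swap_right hs X (f • Y) Z x
  rw [koszul_smul_right hb hs hf hX hZ hY, pair_comm hs, pair_smul_right,
    lieDeriv_mul X hf (mdifferentiableAt_pair hb hZ hY), pair_comm hs Z Y] at h_smul
  linear_combination h_smul - f x * koszul_add_koszul_swap_right hs X Y Z x

lemma koszul_smul_left (hb : IsSmoothBilin b) (hs : ∀ x v w, b x v w = b x w v)
    (hf : MDiffAt f x) (hX : MDiffAt (T% X) x) (hY : MDiffAt (T% Y) x) (hZ : MDiffAt (T% Z) x) :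
    koszul b (f • X) Y Z x = f x * koszul b X Y Z x := by
  have pair_mlieBracket : pair b (VectorField.mlieBracket I (f • X) Y) Z x =
      f x * pair b (VectorField.mlieBracket I X Y) Z x - lieDeriv Y f x * pair b X Z x := by
    simp [pair, VectorField.mlieBracket_smul_left hf hX, lieDeriv, neg_add_eq_sub]
  linear_combination koszul_sub_koszul_swap_left hs (f • X) Y Z x + 2 * pair_mlieBracket
    + koszul_smul_middle hb hs hf hY hX hZ - f x * koszul_sub_koszul_swap_left hs X Y Z x

lemma koszul_add_right (hb : IsSmoothBilin b) (hX : MDiffAt (T% X) x) (hY : MDiffAt (T% Y) x)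
    (hZ : MDiffAt (T% Z) x) (hZ' : MDiffAt (T% Z') x) :
    koszul b X Y (Z + Z') x = koszul b X Y Z x + koszul b X Y Z' x := by
  simp only [koszul, pair_add_right, lieDeriv_add_field, Pi.add_apply,
    lieDeriv_add _ (mdifferentiableAt_pair hb hX hZ) (mdifferentiableAt_pair hb hX hZ'),
    lieDeriv_add _ (mdifferentiableAt_pair hb hY hZ) (mdifferentiableAt_pair hb hY hZ')]
  simp only [pair, VectorField.mlieBracket_add_right hZ hZ', map_add, add_apply]
  ring

lemma koszul_add_middle (hb : IsSmoothBilin b) (hs : ∀ x v w, b x v w = b x w v)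
    (hX : MDiffAt (T% X) x) (hY : MDiffAt (T% Y) x) (hY' : MDiffAt (T% Y') x)
    (hZ : MDiffAt (T% Z) x) :
    koszul b X (Y + Y') Z x = koszul b X Y Z x + koszul b X Y' Z x := by
  have h_add := koszul_add_koszul_swap_right hs X (Y + Y') Z x
  rw [koszul_add_right hb hX hZ hY hY', pair_comm hs, pair_add_right,
    lieDeriv_add X (mdifferentiableAt_pair hb hZ hY) (mdifferentiableAt_pair hb hZ hY'),
    pair_comm hs Z Y, pair_comm hs Z Y'] at h_add
  linear_combination h_add - koszul_add_koszul_swap_right hs X Y Z x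
    - koszul_add_koszul_swap_right hs X Y' Z x

lemma koszul_add_left (hb : IsSmoothBilin b) (hs : ∀ x v w, b x v w = b x w v)
    (hX : MDiffAt (T% X) x) (hX' : MDiffAt (T% X') x) (hY : MDiffAt (T% Y) x)
    (hZ : MDiffAt (T% Z) x) :
    koszul b (X + X') Y Z x = koszul b X Y Z x + koszul b X' Y Z x := by
  have pair_mlieBracket : pair b (VectorField.mlieBracket I (X + X') Y) Z x =
      pair b (VectorField.mlieBracket I X Y) Z x + pair b (VectorField.mlieBracket I X' Y) Z x := by
    simp [pair, VectorField.mlieBracket_add_left hX hX']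
  linear_combination koszul_sub_koszul_swap_left hs (X + X') Y Z x + 2 * pair_mlieBracket
    + koszul_add_middle hb hs hY hX hX' hZ - koszul_sub_koszul_swap_left hs X Y Z x
    - koszul_sub_koszul_swap_left hs X' Y Z x

end Koszul

section LeviCivita

variable {E : Type*} [NormedAddCommGroup E] [NormedSpace ℝ E] [FiniteDimensional ℝ E]
  [CompleteSpace E]
  {H : Type*} [TopologicalSpace H] {I : ModelWithCorners ℝ E H}
  {M : Type*} [TopologicalSpace M] [ChartedSpace H M] [IsManifold I ∞ M] {x : M}
  {X Y Z : Field I M}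

/-- The bilinear form `(v, w) ↦ 2 g(∇_v Y, w)` on `T_x M` given by the Koszul formula, where `∇` is
the Levi-Civita connection of `g`. -/
noncomputable def koszulForm (g : Metric I M) (Y : Field I M) (x : M) (hY : MDiffAt (T% Y) x) :
    TangentSpace I x →L[ℝ] TangentSpace I x →L[ℝ] ℝ :=
  TensorialAt.mkHom₂ (I := I) (F := E) (F' := E) (fun X Z ↦ koszul g.inner X Y Z x) x
    (fun _ hZ ↦ ⟨fun hf hX ↦ koszul_smul_left g.contMDiff g.symm hf hX hY hZ,
      fun hX hX' ↦ koszul_add_left g.contMDiff g.symm hX hX' hY hZ⟩)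
    (fun _ hX ↦ ⟨fun hf hZ ↦ koszul_smul_right g.contMDiff g.symm hf hX hY hZ,
      fun hZ hZ' ↦ koszul_add_right g.contMDiff hX hY hZ hZ'⟩)

lemma koszulForm_apply (g : Metric I M) (hX : MDiffAt (T% X) x) (hY : MDiffAt (T% Y) x)
    (hZ : MDiffAt (T% Z) x) : koszulForm g Y x hY (X x) (Z x) = koszul g.inner X Y Z x :=
  TensorialAt.mkHom₂_apply _ _ hX hZ

open Classical in
/-- The Levi-Civita covariant derivative of `Y` at `x`, obtained from the Koszul formula by raising
an index. Its value is `0` where `Y` is not differentiable. -/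
noncomputable def leviCivitaFun (g : Metric I M) (Y : Field I M) (x : M) :
    TangentSpace I x →L[ℝ] TangentSpace I x :=
  if hY : MDiffAt (T% Y) x then (g.inner x).inverse ∘L ((1 / 2 : ℝ) • koszulForm g Y x hY) else 0

lemma inner_leviCivitaFun (g : Metric I M) (hX : MDiffAt (T% X) x) (hY : MDiffAt (T% Y) x)
    (hZ : MDiffAt (T% Z) x) :
    g.inner x (leviCivitaFun g Y x (X x)) (Z x) = 1 / 2 * koszul g.inner X Y Z x := by
  rw [leviCivitaFun, dif_pos hY, ContinuousLinearMap.comp_apply,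
    (isInvertible_inner g x).self_apply_inverse, ← koszulForm_apply g hX hY hZ]
  simp

lemma isCovariantDerivativeOn_leviCivitaFun (g : Metric I M) :
    IsCovariantDerivativeOn E (leviCivitaFun g) univ where
  add {Y Y' x} hY hY' _ := clm_eq_of_forall_inner_eq g fun X Z hX hZ ↦ by
    rw [inner_leviCivitaFun g hX (mdifferentiableAt_add_section hY hY') hZ,
      koszul_add_middle g.contMDiff g.symm hX hY hY' hZ, add_apply, map_add, add_apply,
      inner_leviCivitaFun g hX hY hZ, inner_leviCivitaFun g hX hY' hZ, mul_add]
  leibniz {Y f x} hY hf _ := clm_eq_of_forall_inner_eq g fun X Z hX hZ ↦ by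
    rw [inner_leviCivitaFun g hX (hf.smul_section hY) hZ,
      koszul_smul_middle g.contMDiff g.symm hf hX hY hZ]
    simp only [add_apply, smul_apply, map_add, map_smul, ContinuousLinearMap.smulRight_apply,
      lieDeriv, smul_eq_mul, inner_leviCivitaFun g hX hY hZ, pair]
    ring

/-- The Levi-Civita connection of a Riemannian metric. -/
noncomputable def leviCivita (g : Metric I M) : LinearConnection I M where
  toFun := leviCivitaFun g
  isCovariantDerivativeOnUniv := isCovariantDerivativeOn_leviCivitaFun g

lemma pair_along_leviCivita (g : Metric I M) (hX : MDiffAt (T% X) x) (hY : MDiffAt (T% Y) x)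
    (hZ : MDiffAt (T% Z) x) :
    pair g.inner (along (leviCivita g) X Y) Z x = 1 / 2 * koszul g.inner X Y Z x :=
  inner_leviCivitaFun g hX hY hZ

lemma isSmoothConnection_leviCivita (g : Metric I M) : IsSmoothConnection (leviCivita g) := by
  refine ⟨⟨fun {Y} hY x _ ↦ ContMDiffAt.contMDiffWithinAt ?_⟩⟩
  have isSmoothField_Y : IsSmoothField Y := contMDiffOn_univ.1 hY
  refine contMDiffAt_hom_of_forall_apply fun X hX ↦
    contMDiffAt_section_of_forall_inner g fun Z hZ ↦ ?_
  have eventually_mdiffAt {W : Field I M} (hW : CMDiffAt ∞ (T% W) x) :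
      ∀ᶠ y in nhds x, MDiffAt (T% W) y :=
    ((contMDiffAt_iff_contMDiffAt_nhds (by simp)).1 (hW.of_le (m := 1) (by simp))).mono
      fun y hy ↦ hy.mdifferentiableAt (by simp)
  have contMDiffAt_half_koszul : CMDiffAt ∞ (fun y ↦ 1 / 2 * koszul g.inner X Y Z y) x :=
    contMDiffAt_const.mul (contMDiffAt_koszul g.contMDiff hX (isSmoothField_Y x) hZ)
  refine contMDiffAt_half_koszul.congr_of_eventuallyEq ?_
  filter_upwards [eventually_mdiffAt hX, eventually_mdiffAt hZ] with y hXy hZy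
  exact pair_along_leviCivita g hXy (isSmoothField_Y.mdiffAt y) hZy

lemma isTorsionFree_leviCivita (g : Metric I M) : IsTorsionFree (leviCivita g) := by
  refine (CovariantDerivative.torsion_eq_zero_iff _).2 fun {X Y x} hX hY ↦ ?_
  refine eq_of_forall_inner_eq g fun u ↦ ?_
  let Z : Field I M := FiberBundle.extend E u
  have hZ : MDiffAt (T% Z) x := FiberBundle.mdifferentiableAt_extend I E u
  have h := koszul_sub_koszul_swap_left g.symm X Y Z x
  have hXY := pair_along_leviCivita g hX hY hZ
  have hYX := pair_along_leviCivita g hY hX hZ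
  simp only [pair, along, Z, FiberBundle.extend_apply_self] at h hXY hYX
  rw [map_sub, sub_apply]
  linear_combination hXY - hYX + h / 2

lemma lieDeriv_pair_leviCivita (g : Metric I M) (hX : MDiffAt (T% X) x) (hY : MDiffAt (T% Y) x)
    (hZ : MDiffAt (T% Z) x) :
    lieDeriv X (pair g.inner Y Z) x = pair g.inner (along (leviCivita g) X Y) Z x
      + pair g.inner Y (along (leviCivita g) X Z) x := by
  rw [pair_comm g.symm Y (along (leviCivita g) X Z), pair_along_leviCivita g hX hY hZ,
    pair_along_leviCivita g hX hZ hY]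
  linear_combination -(koszul_add_koszul_swap_right g.symm X Y Z x) / 2

lemma isDual_leviCivita (g : Metric I M) : IsDual g (leviCivita g) (leviCivita g) where
  smooth_left := isSmoothConnection_leviCivita g
  smooth_right := isSmoothConnection_leviCivita g
  duality _ _ _ hX hY hZ x :=
    lieDeriv_pair_leviCivita g (hX.mdiffAt x) (hY.mdiffAt x) (hZ.mdiffAt x)

end LeviCivita

section AlmostHermitian

variable {E : Type*} [NormedAddCommGroup E] [NormedSpace ℝ E]
  {H : Type*} [TopologicalSpace H] {I : ModelWithCorners ℝ E H}
  {M : Type*} [TopologicalSpace M] [ChartedSpace H M] [IsManifold I ∞ M]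
  {Ω : BilinField I M} {Θ : EndField I M} {g : Metric I M}

/-- `(M, Θ, g)` is almost Hermitian: `Θ` is an almost complex structure and `g` is invariant under
it. -/
structure IsAlmostHermitian (Θ : EndField I M) (g : Metric I M) : Prop where
  almostComplex : IsAlmostComplex Θ
  hermitian : ∀ (x : M) (v w : TangentSpace I x), g.inner x (Θ x v) (Θ x w) = g.inner x v w

/-- The fundamental 2-form `g(Θ·,·)` of an almost Hermitian manifold `(M, Θ, g)`. -/
noncomputable def fundamentalForm (g : Metric I M) (Θ : EndField I M) : BilinField I M :=
  fun x ↦ (g.inner x).comp (Θ x)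

lemma IsAlmostKahler.isAlmostHermitian (h : IsAlmostKahler Ω Θ g) : IsAlmostHermitian Θ g :=
  ⟨h.almostComplex, h.hermitian⟩

lemma IsAlmostKahler.eq_fundamentalForm (h : IsAlmostKahler Ω Θ g) : Ω = fundamentalForm g Θ := by
  ext x v w
  exact h.fundamental x v w

lemma pair_fundamentalForm (g : Metric I M) (Θ : EndField I M) (X Y : Field I M) :
    pair (fundamentalForm g Θ) X Y = pair g.inner (act Θ X) Y :=
  rfl

lemma IsAlmostComplex.act_act (h : IsAlmostComplex Θ) (X : Field I M) : act Θ (act Θ X) = -X :=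
  funext fun x ↦ h.sq x _

namespace IsAlmostHermitian

lemma pair_act_act (h : IsAlmostHermitian Θ g) (X Y : Field I M) :
    pair g.inner (act Θ X) (act Θ Y) = pair g.inner X Y :=
  funext fun x ↦ h.hermitian x _ _

lemma pair_act_left (h : IsAlmostHermitian Θ g) (X Y : Field I M) :
    pair g.inner (act Θ X) Y = -pair g.inner X (act Θ Y) := by
  rw [← h.pair_act_act X (act Θ Y), h.almostComplex.act_act, pair_comm g.symm _ (-Y),
    pair_neg_left, neg_neg, pair_comm g.symm]

lemma koszul_act_add_koszul_act (h : IsAlmostHermitian Θ g) (X Y Z : Field I M) (x : M) :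
    koszul g.inner X (act Θ Y) Z x + koszul g.inner X Y (act Θ Z) x =
      extDerivTwoForm (fundamentalForm g Θ) X Y Z x
        - extDerivTwoForm (fundamentalForm g Θ) X (act Θ Y) (act Θ Z) x
        + pair g.inner (nijenhuis Θ Y Z) (act Θ X) x := by
  have pair_nijenhuis : pair g.inner (nijenhuis Θ Y Z) (act Θ X) x =
      pair g.inner (VectorField.mlieBracket I (act Θ Y) (act Θ Z)) (act Θ X) x
        - pair g.inner (VectorField.mlieBracket I (act Θ Y) Z) X x
        - pair g.inner (VectorField.mlieBracket I Y (act Θ Z)) X x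
        - pair g.inner (VectorField.mlieBracket I Y Z) (act Θ X) x := by
    simp only [pair, nijenhuis, act, map_sub, sub_apply, h.hermitian]
  rw [pair_nijenhuis]
  simp only [koszul, extDerivTwoForm, pair_fundamentalForm, h.pair_act_left,
    h.almostComplex.act_act, VectorField.mlieBracket_swap (V := Z) (W := X),
    VectorField.mlieBracket_swap (V := act Θ Z) (W := X), pair_comm g.symm Z, pair_neg_left,
    pair_neg_right, lieDeriv_neg, Pi.neg_apply]
  ring

end IsAlmostHermitian

end AlmostHermitian

section Kahler

variable {E : Type*} [NormedAddCommGroup E] [NormedSpace ℝ E] [FiniteDimensional ℝ E]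
  {H : Type*} [TopologicalSpace H] {I : ModelWithCorners ℝ E H}
  {M : Type*} [TopologicalSpace M] [ChartedSpace H M] [IsManifold I ∞ M]
  {Ω : BilinField I M} {Θ : EndField I M} {g : Metric I M} {X Y Z : Field I M}
  {D D' : LinearConnection I M}

lemma IsAlmostHermitian.act_along_eq_along_act [T2Space M] (h : IsAlmostHermitian Θ g)
    (parallel : IsParallel D (fundamentalForm g Θ)) (dual : IsDual g D D')
    (hX : IsSmoothField X) (hY : IsSmoothField Y) :
    act Θ (along D' X Y) = along D X (act Θ Y) := by
  funext x
  refine eq_of_forall_inner_eq g fun u ↦ ?_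
  obtain ⟨Z, hZ, hZx⟩ := exists_contMDiff_section_eq (I := I) (F := E) (-Θ x u)
  have act_Z : Θ x (Z x) = u := by rw [hZx, map_neg, h.almostComplex.sq, neg_neg]
  suffices pair_act_Z : pair g.inner (act Θ Z) (act Θ (along D' X Y)) x =
      pair g.inner (act Θ Z) (along D X (act Θ Y)) x by
    simpa only [pair, act, act_Z, g.symm x u] using pair_act_Z
  have dual_XZY := dual.duality X Z Y hX hZ hY x
  have parallel_XZY := parallel X Z (act Θ Y) hX hZ (hY.act h.almostComplex.smooth) x
  simp only [pair_fundamentalForm, h.pair_act_act] at parallel_XZY ⊢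
  linear_combination parallel_XZY - dual_XZY

variable [CompleteSpace E]

lemma IsAlmostHermitian.two_mul_pair_along_leviCivita_act_sub (h : IsAlmostHermitian Θ g)
    (hX : IsSmoothField X) (hY : IsSmoothField Y) (hZ : IsSmoothField Z) (x : M) :
    2 * (pair g.inner (along (leviCivita g) X (act Θ Y)) Z x
        - pair g.inner (act Θ (along (leviCivita g) X Y)) Z x) =
      extDerivTwoForm (fundamentalForm g Θ) X Y Z x
        - extDerivTwoForm (fundamentalForm g Θ) X (act Θ Y) (act Θ Z) x
        + pair g.inner (nijenhuis Θ Y Z) (act Θ X) x := by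
  have hΘ := h.almostComplex.smooth
  rw [h.pair_act_left, Pi.neg_apply, ← h.koszul_act_add_koszul_act,
    pair_along_leviCivita g (hX.mdiffAt x) ((hY.act hΘ).mdiffAt x) (hZ.mdiffAt x),
    pair_along_leviCivita g (hX.mdiffAt x) (hY.mdiffAt x) ((hZ.act hΘ).mdiffAt x)]
  ring

lemma IsKahler.pair_along_leviCivita_act (h : IsKahler Ω Θ g) (hX : IsSmoothField X)
    (hY : IsSmoothField Y) (hZ : IsSmoothField Z) (x : M) :
    pair g.inner (along (leviCivita g) X (act Θ Y)) Z x =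
      pair g.inner (act Θ (along (leviCivita g) X Y)) Z x := by
  have hK := h.almostKahler
  have hΘ := hK.almostComplex.smooth
  have nijenhuis_term : pair g.inner (nijenhuis Θ Y Z) (act Θ X) x = 0 := by
    simp [pair, h.integrable Y Z hY hZ x]
  have formula := hK.isAlmostHermitian.two_mul_pair_along_leviCivita_act_sub hX hY hZ x
  rw [← hK.eq_fundamentalForm, hK.symplectic.closed X Y Z hX hY hZ x,
    hK.symplectic.closed X _ _ hX (hY.act hΘ) (hZ.act hΘ) x, nijenhuis_term] at formula
  linear_combination formula / 2

lemma IsKahler.isSymplecticConnection_leviCivita (h : IsKahler Ω Θ g) :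
    IsSymplecticConnection Ω (leviCivita g) where
  smooth := isSmoothConnection_leviCivita g
  torsionFree := isTorsionFree_leviCivita g
  parallel X Y Z hX hY hZ x := by
    have mdiffAt_act_Y := (hY.act h.almostKahler.almostComplex.smooth).mdiffAt x
    simp only [h.almostKahler.eq_fundamentalForm, pair_fundamentalForm]
    rw [lieDeriv_pair_leviCivita g (hX.mdiffAt x) mdiffAt_act_Y (hZ.mdiffAt x),
      h.pair_along_leviCivita_act hX hY hZ]

lemma IsAlmostComplex.isIntegrable_of_act_along_eq_along_act (h : IsAlmostComplex Θ)
    (torsionFree : IsTorsionFree D) (torsionFree' : IsTorsionFree D')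
    (act_along : ∀ X Y : Field I M, IsSmoothField X → IsSmoothField Y →
      act Θ (along D' X Y) = along D X (act Θ Y)) : IsIntegrable Θ := by
  intro X Y hX hY x
  have hX' := hX.act h.smooth
  have hY' := hY.act h.smooth
  have act_mlieBracket {X Y : Field I M} (hX : IsSmoothField X) (hY : IsSmoothField Y) :
      Θ x (VectorField.mlieBracket I X Y x) = along D X (act Θ Y) x - along D Y (act Θ X) x := by
    rw [← act_along X Y hX hY, ← act_along Y X hY hX,
      ← (D'.torsion_eq_zero_iff.1 torsionFree') (hX.mdiffAt x) (hY.mdiffAt x), map_sub]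
    rfl
  have along_neg {X Y : Field I M} (hY : IsSmoothField Y) : along D X (-Y) x = -along D X Y x := by
    have neg_eq := D.isCovariantDerivativeOnUniv.smul_const (-1 : ℝ) (hY.mdiffAt x)
    simpa [along] using congr($neg_eq (X x))
  rw [nijenhuis, act_mlieBracket hX' hY, act_mlieBracket hX hY', h.act_act, h.act_act,
    along_neg hX, along_neg hY,
    ← (D.torsion_eq_zero_iff.1 torsionFree) (hX.mdiffAt x) (hY.mdiffAt x),
    ← (D.torsion_eq_zero_iff.1 torsionFree) (hX'.mdiffAt x) (hY'.mdiffAt x)]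
  simp only [along]
  abel

variable [T2Space M]

lemma IsAlmostKahler.isKahler_of_isDual (h : IsAlmostKahler Ω Θ g)
    (symplectic : IsSymplecticConnection Ω D) (dual : IsDual g D D')
    (torsionFree' : IsTorsionFree D') : IsKahler Ω Θ g where
  almostKahler := h
  integrable := h.almostComplex.isIntegrable_of_act_along_eq_along_act symplectic.torsionFree
    torsionFree' fun _ _ ↦ h.isAlmostHermitian.act_along_eq_along_act
      (h.eq_fundamentalForm ▸ symplectic.parallel) dual

lemma isKahler_iff_isStatisticalAlmostKahler :
    IsKahler Ω Θ g ↔ IsStatisticalAlmostKahler Ω Θ g := by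
  constructor
  · intro h
    exact ⟨h.almostKahler, (leviCivita g, leviCivita g),
      ⟨h.isSymplecticConnection_leviCivita, isDual_leviCivita g⟩,
      isDual_leviCivita g, isTorsionFree_leviCivita g, isTorsionFree_leviCivita g⟩
  · rintro ⟨almostKahler, ⟨D, D'⟩, ⟨symplectic, dual⟩, statistical⟩
    exact almostKahler.isKahler_of_isDual symplectic dual statistical.torsionFree_right

lemma isKahlerMetric_iff_exists_isSymplecticConnection_isDual :
    IsKahlerMetric Ω g ↔ IsHermitianMetric Ω g ∧ ∃ D D' : LinearConnection I M,
      IsSymplecticConnection Ω D ∧ IsDual g D D' ∧ IsSymplecticConnection Ω D' := by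
  constructor
  · rintro ⟨J, h⟩
    exact ⟨⟨J, h.almostKahler⟩, leviCivita g, leviCivita g, h.isSymplecticConnection_leviCivita,
      isDual_leviCivita g, h.isSymplecticConnection_leviCivita⟩
  · rintro ⟨⟨J, almostKahler⟩, D, D', symplectic, dual, symplectic'⟩
    exact ⟨J, almostKahler.isKahler_of_isDual symplectic dual symplectic'.torsionFree⟩

end Kahler

end AlmostKahlerGeometry

open AlmostKahlerGeometry in
theorem mainTheorem6_general {E : Type*} [NormedAddCommGroup E] [NormedSpace ℝ E]
    [FiniteDimensional ℝ E] [CompleteSpace E]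
    {H : Type*} [TopologicalSpace H] {I : ModelWithCorners ℝ E H}
    {M : Type*} [TopologicalSpace M] [T2Space M] [ChartedSpace H M] [IsManifold I ∞ M]
    (Ω : BilinField I M) :
    (∀ (Θ : EndField I M) (g : Metric I M),
      IsKahler Ω Θ g ↔ IsStatisticalAlmostKahler Ω Θ g) ∧
    (∀ h : Metric I M, IsKahlerMetric Ω h ↔ IsHermitianMetric Ω h ∧
      ∃ D D' : LinearConnection I M, IsSymplecticConnection Ω D ∧ IsDual h D D' ∧
        IsSymplecticConnection Ω D') :=
  ⟨fun _ _ ↦ isKahler_iff_isStatisticalAlmostKahler,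
    fun _ ↦ isKahlerMetric_iff_exists_isSymplecticConnection_isDual⟩

theorem mainTheorem6 {E : Type*} [NormedAddCommGroup E] [NormedSpace ℝ E]
    [FiniteDimensional ℝ E] [CompleteSpace E]
    {H : Type*} [TopologicalSpace H] {I : ModelWithCorners ℝ E H} [I.Boundaryless]
    {M : Type*} [TopologicalSpace M] [T2Space M] [ChartedSpace H M] [IsManifold I ∞ M]
    (Ω : AlmostKahlerGeometry.BilinField I M) (Θ : AlmostKahlerGeometry.EndField I M)
    (g : AlmostKahlerGeometry.Metric I M) (hM : AlmostKahlerGeometry.IsAlmostKahler Ω Θ g) :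
    (AlmostKahlerGeometry.IsKahler Ω Θ g ↔
      AlmostKahlerGeometry.IsStatisticalAlmostKahler Ω Θ g) ∧
    (∀ h : AlmostKahlerGeometry.Metric I M,
      AlmostKahlerGeometry.IsKahlerMetric Ω h ↔
        AlmostKahlerGeometry.IsHermitianMetric Ω h ∧
        ∃ D D' : AlmostKahlerGeometry.LinearConnection I M,
          AlmostKahlerGeometry.IsSymplecticConnection Ω D ∧
          AlmostKahlerGeometry.IsDual h D D' ∧
          AlmostKahlerGeometry.IsSymplecticConnection Ω D') :=
  ⟨(mainTheorem6_general Ω).1 Θ g, (mainTheorem6_general Ω).2⟩
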